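/- All objects are smooth, and for a one-form $\alpha$ we use the convention $2\,d\alpha(X,Y)=X(\alpha(Y))-Y(\alpha(X))-\alpha([X,Y])$. Let $h,k\ge 0$ be integers and let $M$ be a manifold of dimension $2h+2k+2$. A pair $(\alpha_1,\alpha_2)$ of one-forms on $M$ is a contact pair of type $(h,k)$ if $\alpha_1\wedge(d\alpha_1)^h\wedge\alpha_2\wedge(d\alpha_2)^k$ is a volume form, $(d\alpha_1)^{h+1}=0$ and $(d\alpha_2)^{k+1}=0$. Its Reeb vector fields $Z_1,Z_2$ are the vector fields determined by $\alpha_i(Z_j)=\delta_{ij}$ and $i_{Z_j}d\alpha_i=0$ for $i,j\in\{1,2\}$. A metric contact pair (MCP) $(\alpha_1,\alpha_2,\phi,g)$ on $M$ consists of a contact pair $(\alpha_1,\alpha_2)$ of some type $(h,k)$, a $(1,1)$-tensor field $\phi$ with $$\phi^2=-\mathrm{Id}+\alpha_1\otimes Z_1+\alpha_2\otimes Z_2,\qquad \phi Z_1=\phi Z_2=0,$$ and a Riemannian metric $g$ with $g(X,\phi Y)=(d\alpha_1+d\alpha_2)(X,Y)$ and $g(X,Z_i)=\alpha_i(X)$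 for $i=1,2$ and all vector fields $X,Y$. The tensor $\phi$ is decomposable if it maps $\ker\alpha_i\cap\ker d\alpha_i$ into itself for $i=1,2$. Put $Z=Z_1+Z_2$ and let $\mathbf h=\tfrac12\mathcal L_Z\phi$, that is, $\mathbf hX=\tfrac12([Z,\phi X]-\phi[Z,X])$. Let $\nabla$ be the Levi-Civita connection of $g$ and $R_{XY}W=\nabla_X\nabla_YW-\nabla_Y\nabla_XW-\nabla_{[X,Y]}W$ its curvature. **Proposition.** Let $(\alpha_1,\alpha_2,\phi,g)$ be an MCP with decomposable $\phi$ on $M$. Then for every vector field $X$ on $M$, $$(\nabla_Z\mathbf h)X=\phi X-\mathbf h^2\phi X-\phi R_{XZ}Z,$$ $$\tfrac12\bigl(R_{ZX}Z-\phi(R_{Z\,\phi X}Z)\bigr)=\phi^2X+\mathbf h^2X.$$ -/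

import Mathlib

open Bundle Module
open scoped Manifold ContDiff

namespace ContactPairs

noncomputable section

/-! ### Exterior algebra of a vector space -/

section Wedge

variable {V : Type*} [AddCommGroup V] [Module ℝ V]

/-- Wedge product of scalar valued alternating forms (sum over shuffles). -/
def wedge {m n : ℕ} (a : V [⋀^Fin m]→ₗ[ℝ] ℝ) (b : V [⋀^Fin n]→ₗ[ℝ] ℝ) :
    V [⋀^Fin (m + n)]→ₗ[ℝ] ℝ :=
  ((LinearMap.mul' ℝ ℝ).compAlternatingMap (a.domCoprod b)).domDomCongr finSumFinEquiv

/-- The `n`-th exterior power of a `2`-form `w`, with `w ^ 0 = 1`. -/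
def wedgePow (w : V [⋀^Fin 2]→ₗ[ℝ] ℝ) : (n : ℕ) → V [⋀^Fin (2 * n)]→ₗ[ℝ] ℝ
  | 0 => AlternatingMap.constOfIsEmpty ℝ V (Fin 0) (1 : ℝ)
  | n + 1 => wedge (wedgePow w n) w

/-- A linear form as an alternating form of degree one. -/
def formOne (a : V →ₗ[ℝ] ℝ) : V [⋀^Fin 1]→ₗ[ℝ] ℝ :=
  AlternatingMap.ofSubsingleton ℝ V ℝ (0 : Fin 1) a

/-- A bilinear form `B` with `B v v = 0` as an alternating form of degree two. -/
def formTwo (B : V →ₗ[ℝ] V →ₗ[ℝ] ℝ) (hB : ∀ v, B v v = 0) : V [⋀^Fin 2]→ₗ[ℝ] ℝ where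
  toFun v := B (v 0) (v 1)
  map_update_add' v i a b := by fin_cases i <;> simp
  map_update_smul' v i c a := by fin_cases i <;> simp
  map_eq_zero_of_eq' v i j hij hne := by
    have h01 : v 0 = v 1 := by
      fin_cases i <;> fin_cases j <;> simp_all
    rw [h01]
    exact hB _

end Wedge

variable {E : Type*} [NormedAddCommGroup E] [NormedSpace ℝ E]
  {H : Type*} [TopologicalSpace H] (I : ModelWithCorners ℝ E H)
  (M : Type*) [TopologicalSpace M] [ChartedSpace H M]

/-! ### Smooth tensor fields -/

section Fields

variable [IsManifold I ∞ M]

/-- Smooth vector fields on `M`. -/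
structure VField where
  toFun : Π x : M, TangentSpace I x
  contMDiff : ContMDiff I (I.prod 𝓘(ℝ, E)) ∞
    (fun x ↦ TotalSpace.mk' E (E := fun x : M ↦ TangentSpace I x) x (toFun x))

/-- Smooth one-forms on `M`. -/
structure OneForm where
  toFun : Π x : M, TangentSpace I x →L[ℝ] ℝ
  contMDiff : ContMDiff I (I.prod 𝓘(ℝ, E →L[ℝ] ℝ)) ∞
    (fun x ↦ TotalSpace.mk' (E →L[ℝ] ℝ)
      (E := fun x : M ↦ TangentSpace I x →L[ℝ] Bundle.Trivial M ℝ x) x (toFun x))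

/-- Smooth tensor fields of type `(1,1)` on `M`. -/
structure EndoField where
  toFun : Π x : M, TangentSpace I x →L[ℝ] TangentSpace I x
  contMDiff : ContMDiff I (I.prod 𝓘(ℝ, E →L[ℝ] E)) ∞
    (fun x ↦ TotalSpace.mk' (E →L[ℝ] E)
      (E := fun x : M ↦ TangentSpace I x →L[ℝ] TangentSpace I x) x (toFun x))

instance : CoeFun (VField I M) (fun _ ↦ Π x : M, TangentSpace I x) := ⟨VField.toFun⟩
instance : CoeFun (OneForm I M) (fun _ ↦ Π x : M, TangentSpace I x →L[ℝ] ℝ) :=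
  ⟨OneForm.toFun⟩
instance : CoeFun (EndoField I M)
    (fun _ ↦ Π x : M, TangentSpace I x →L[ℝ] TangentSpace I x) := ⟨EndoField.toFun⟩

end Fields

variable {I M}
variable [IsManifold I ∞ M]

lemma OneForm.mdifferentiableAt_apply (α : OneForm I M) {X : Π x : M, TangentSpace I x} {x : M}
    (hX : MDiffAt (T% X) x) : MDiffAt (fun y ↦ α y (X y)) x := by
  have h := (α.contMDiff.mdifferentiable (by simp) x).clm_bundle_apply hX
  rw [mdifferentiableAt_totalSpace] at h
  exact h.2

lemma EndoField.mdifferentiableAt_apply (φ : EndoField I M) {X : Π x : M, TangentSpace I x}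
    {x : M} (hX : MDiffAt (T% X) x) : MDiffAt (T% (fun y ↦ φ y (X y))) x :=
  (φ.contMDiff.mdifferentiable (by simp) x).clm_bundle_apply hX

lemma VField.mdifferentiableAt (X : VField I M) (x : M) : MDiffAt (T% X.toFun) x :=
  X.contMDiff.mdifferentiable (by simp) x

/-- Sum of two smooth vector fields. -/
def VField.add (X Y : VField I M) : VField I M where
  toFun x := X x + Y x
  contMDiff := X.contMDiff.add_section Y.contMDiff

/-! ### Exterior derivative of a one-form, with the factor `1/2` -/

/-- `dα(X,Y) = (X(α(Y)) - Y(α(X)) - α([X,Y])) / 2` at `x`. -/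
def extDerAux (α : OneForm I M) (X Y : Π x : M, TangentSpace I x) (x : M) : ℝ :=
  (1 / 2 : ℝ) * (d% (fun y ↦ α y (Y y)) x (X x) - d% (fun y ↦ α y (X y)) x (Y x)
    - α x (VectorField.mlieBracket I X Y x))

lemma extDerAux_swap (α : OneForm I M) (X Y : Π x : M, TangentSpace I x) (x : M) :
    extDerAux α X Y x = - extDerAux α Y X x := by
  simp only [extDerAux, VectorField.mlieBracket_swap_apply (V := X) (W := Y), map_neg]
  ring

variable [FiniteDimensional ℝ E]

lemma extDerAux_tensorial (α : OneForm I M) (X : Π x : M, TangentSpace I x) (x : M) :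
    TensorialAt I E (extDerAux α X · x) x where
  smul {f Y} hf hY := by
    have := FiniteDimensional.complete ℝ E
    have h1 : (fun y ↦ α y ((f • Y) y)) = fun y ↦ f y * α y (Y y) := by ext y; simp
    simp only [extDerAux]
    rw [h1, mvfderiv_fun_mul hf (α.mdifferentiableAt_apply hY),
      VectorField.mlieBracket_smul_right hf hY]
    simp
    ring
  add {Y Y'} hY hY' := by
    have := FiniteDimensional.complete ℝ E
    have h1 : (fun y ↦ α y ((Y + Y') y)) = fun y ↦ α y (Y y) + α y (Y' y) := by ext y; simp
    simp only [extDerAux]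
    rw [h1, mvfderiv_fun_add (α.mdifferentiableAt_apply hY) (α.mdifferentiableAt_apply hY'),
      VectorField.mlieBracket_add_right hY hY']
    simp
    ring

lemma extDerAux_tensorial' (α : OneForm I M) (Y : Π x : M, TangentSpace I x) (x : M) :
    TensorialAt I E (extDerAux α · Y x) x where
  smul {f X} hf hX := by
    rw [extDerAux_swap, (extDerAux_tensorial α Y x).smul hf hX, extDerAux_swap α X Y]
    simp
  add {X X'} hX hX' := by
    rw [extDerAux_swap, (extDerAux_tensorial α Y x).add hX hX', extDerAux_swap α X Y,
      extDerAux_swap α X' Y]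
    ring

/-- The exterior derivative `dα` of a one-form at `x`, as a bilinear form on `T_x M`, with the
convention `2 dα(X,Y) = X(α(Y)) - Y(α(X)) - α([X,Y])`. -/
def extDer (α : OneForm I M) (x : M) : TangentSpace I x →L[ℝ] TangentSpace I x →L[ℝ] ℝ :=
  TensorialAt.mkHom₂ (extDerAux α · · x) x
    (fun Y _ ↦ extDerAux_tensorial' α Y x) (fun X _ ↦ extDerAux_tensorial α X x)

lemma extDer_apply (α : OneForm I M) {X Y : Π x : M, TangentSpace I x} {x : M}
    (hX : MDiffAt (T% X) x) (hY : MDiffAt (T% Y) x) :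
    extDer α x (X x) (Y x) =
      (1 / 2 : ℝ) * (d% (fun y ↦ α y (Y y)) x (X x) - d% (fun y ↦ α y (X y)) x (Y x)
        - α x (VectorField.mlieBracket I X Y x)) :=
  TensorialAt.mkHom₂_apply _ _ hX hY

lemma extDer_self (α : OneForm I M) (x : M) (v : TangentSpace I x) : extDer α x v v = 0 := by
  have h : extDer α x v v = extDerAux α (FiberBundle.extend E v) (FiberBundle.extend E v) x :=
    TensorialAt.mkHom₂_apply_eq_extend _ _ v v
  have h2 := extDerAux_swap α (FiberBundle.extend E v) (FiberBundle.extend E v) x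
  rw [h]
  linarith

/-- `α` at `x` as an alternating form of degree one. -/
def altOne (α : OneForm I M) (x : M) : TangentSpace I x [⋀^Fin 1]→ₗ[ℝ] ℝ :=
  formOne (α x).toLinearMap

/-- `dα` at `x` as an alternating form of degree two. -/
def altTwo (α : OneForm I M) (x : M) : TangentSpace I x [⋀^Fin 2]→ₗ[ℝ] ℝ :=
  formTwo ((ContinuousLinearMap.coeLM ℝ).comp (extDer α x).toLinearMap) (extDer_self α x)

/-! ### Lie derivative of an endomorphism field -/

lemma lieDerEndo_tensorial (Z : VField I M) (φ : EndoField I M) (x : M) :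
    TensorialAt I E (fun X : Π x : M, TangentSpace I x ↦
      VectorField.mlieBracket I Z (fun y ↦ φ y (X y)) x
        - φ x (VectorField.mlieBracket I Z X x)) x where
  smul {f X} hf hX := by
    have := FiniteDimensional.complete ℝ E
    have h1 : (fun y ↦ φ y ((f • X) y)) = f • (fun y ↦ φ y (X y)) := by ext y; simp
    rw [h1, VectorField.mlieBracket_smul_right hf (φ.mdifferentiableAt_apply hX),
      VectorField.mlieBracket_smul_right hf hX]
    simp only [map_add, map_smul]
    module
  add {X X'} hX hX' := by
    have := FiniteDimensional.complete ℝ E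
    have h1 : (fun y ↦ φ y ((X + X') y)) = (fun y ↦ φ y (X y)) + (fun y ↦ φ y (X' y)) := by
      ext y; simp
    rw [h1, VectorField.mlieBracket_add_right (φ.mdifferentiableAt_apply hX)
      (φ.mdifferentiableAt_apply hX'), VectorField.mlieBracket_add_right hX hX']
    simp only [map_add]
    module

/-- The Lie derivative `(L_Z φ) X = [Z, φ X] - φ [Z, X]`, as an endomorphism of `T_x M`. -/
def lieDerEndo (Z : VField I M) (φ : EndoField I M) (x : M) :
    TangentSpace I x →L[ℝ] TangentSpace I x :=
  TensorialAt.mkHom _ x (lieDerEndo_tensorial Z φ x)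

lemma lieDerEndo_apply (Z : VField I M) (φ : EndoField I M) {X : Π x : M, TangentSpace I x}
    {x : M} (hX : MDiffAt (T% X) x) :
    lieDerEndo Z φ x (X x) = VectorField.mlieBracket I Z (fun y ↦ φ y (X y)) x
      - φ x (VectorField.mlieBracket I Z X x) :=
  TensorialAt.mkHom_apply (lieDerEndo_tensorial Z φ x) hX

/-! ### The Levi-Civita connection -/

variable (I M) in
/-- Smooth Riemannian metrics on `M`. -/
abbrev Metric := ContMDiffRiemannianMetric I ∞ E (fun x : M ↦ TangentSpace I x)

lemma Metric.mdifferentiableAt_apply (g : Metric I M) {X Y : Π x : M, TangentSpace I x} {x : M}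
    (hX : MDiffAt (T% X) x) (hY : MDiffAt (T% Y) x) :
    MDiffAt (fun y ↦ g.inner y (X y) (Y y)) x := by
  have h := (g.contMDiff.mdifferentiable (by simp) x)
  have h2 : MDifferentiableAt I (I.prod 𝓘(ℝ))
      (fun m ↦ TotalSpace.mk' ℝ (E := Bundle.Trivial M ℝ) m (g.inner m (X m) (Y m))) x :=
    MDifferentiableAt.clm_bundle_apply₂ (F₁ := E) (F₂ := E) h hX hY
  rw [mdifferentiableAt_totalSpace] at h2
  exact h2.2

/-- The right-hand side of Koszul's formula for `g(∇_X Y, W)`. -/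
def koszul (g : Metric I M) (X Y W : Π x : M, TangentSpace I x) (x : M) : ℝ :=
  (1 / 2 : ℝ) * (d% (fun y ↦ g.inner y (Y y) (W y)) x (X x)
    + d% (fun y ↦ g.inner y (W y) (X y)) x (Y x)
    - d% (fun y ↦ g.inner y (X y) (Y y)) x (W x)
    + g.inner x (VectorField.mlieBracket I X Y x) (W x)
    - g.inner x (VectorField.mlieBracket I Y W x) (X x)
    + g.inner x (VectorField.mlieBracket I W X x) (Y x))

lemma koszul_tensorial_right (g : Metric I M) {X Y : Π x : M, TangentSpace I x} {x : M}
    (hX : MDiffAt (T% X) x) (hY : MDiffAt (T% Y) x) :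
    TensorialAt I E (fun W ↦ koszul g X Y W x) x where
  smul {f W} hf hW := by
    have := FiniteDimensional.complete ℝ E
    have h1 : (fun y ↦ g.inner y (Y y) ((f • W) y)) = fun y ↦ f y * g.inner y (Y y) (W y) := by
      ext y; simp
    have h2 : (fun y ↦ g.inner y ((f • W) y) (X y)) = fun y ↦ f y * g.inner y (W y) (X y) := by
      ext y; simp
    simp only [koszul]
    rw [h1, h2, mvfderiv_fun_mul hf (g.mdifferentiableAt_apply hY hW),
      mvfderiv_fun_mul hf (g.mdifferentiableAt_apply hW hX),
      VectorField.mlieBracket_smul_right hf hW, VectorField.mlieBracket_smul_left hf hW]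
    simp [g.symm x (Y x) (W x)]
    ring
  add {W W'} hW hW' := by
    have := FiniteDimensional.complete ℝ E
    have h1 : (fun y ↦ g.inner y (Y y) ((W + W') y)) =
        fun y ↦ g.inner y (Y y) (W y) + g.inner y (Y y) (W' y) := by
      ext y; simp
    have h2 : (fun y ↦ g.inner y ((W + W') y) (X y)) =
        fun y ↦ g.inner y (W y) (X y) + g.inner y (W' y) (X y) := by
      ext y; simp
    simp only [koszul]
    rw [h1, h2, mvfderiv_fun_add (g.mdifferentiableAt_apply hY hW)
        (g.mdifferentiableAt_apply hY hW'),
      mvfderiv_fun_add (g.mdifferentiableAt_apply hW hX) (g.mdifferentiableAt_apply hW' hX),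
      VectorField.mlieBracket_add_right hW hW', VectorField.mlieBracket_add_left hW hW']
    simp
    ring

lemma koszul_tensorial_left (g : Metric I M) {Y W : Π x : M, TangentSpace I x} {x : M}
    (hY : MDiffAt (T% Y) x) (hW : MDiffAt (T% W) x) :
    TensorialAt I E (fun X ↦ koszul g X Y W x) x where
  smul {f X} hf hX := by
    have := FiniteDimensional.complete ℝ E
    have h1 : (fun y ↦ g.inner y (W y) ((f • X) y)) = fun y ↦ f y * g.inner y (W y) (X y) := by
      ext y; simp
    have h2 : (fun y ↦ g.inner y ((f • X) y) (Y y)) = fun y ↦ f y * g.inner y (X y) (Y y) := by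
      ext y; simp
    simp only [koszul]
    rw [h1, h2, mvfderiv_fun_mul hf (g.mdifferentiableAt_apply hW hX),
      mvfderiv_fun_mul hf (g.mdifferentiableAt_apply hX hY),
      VectorField.mlieBracket_smul_right hf hX, VectorField.mlieBracket_smul_left hf hX]
    simp [g.symm x (W x) (X x)]
    ring
  add {X X'} hX hX' := by
    have := FiniteDimensional.complete ℝ E
    have h1 : (fun y ↦ g.inner y (W y) ((X + X') y)) =
        fun y ↦ g.inner y (W y) (X y) + g.inner y (W y) (X' y) := by
      ext y; simp
    have h2 : (fun y ↦ g.inner y ((X + X') y) (Y y)) =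
        fun y ↦ g.inner y (X y) (Y y) + g.inner y (X' y) (Y y) := by
      ext y; simp
    simp only [koszul]
    rw [h1, h2, mvfderiv_fun_add (g.mdifferentiableAt_apply hW hX)
        (g.mdifferentiableAt_apply hW hX'),
      mvfderiv_fun_add (g.mdifferentiableAt_apply hX hY) (g.mdifferentiableAt_apply hX' hY),
      VectorField.mlieBracket_add_right hX hX', VectorField.mlieBracket_add_left hX hX']
    simp
    ring

lemma Metric.eq_of_inner_eq (g : Metric I M) {x : M} {v w : TangentSpace I x}
    (h : ∀ u, g.inner x v u = g.inner x w u) : v = w := by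
  by_contra hne
  have h1 := g.pos x (v - w) (sub_ne_zero.2 hne)
  have h2 : g.inner x (v - w) (v - w) = g.inner x v (v - w) - g.inner x w (v - w) := by
    simp only [map_sub, sub_apply]
    ring
  rw [h2, h (v - w), sub_self] at h1
  exact lt_irrefl _ h1

lemma Metric.isInvertible_inner (g : Metric I M) (x : M) : (g.inner x).IsInvertible := by
  have hfd : FiniteDimensional ℝ (TangentSpace I x) := inferInstanceAs (FiniteDimensional ℝ E)
  have hT : T2Space (TangentSpace I x) := inferInstanceAs (T2Space E)
  have hinj : Function.Injective (g.inner x) := fun v w hvw ↦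
    g.eq_of_inner_eq fun u ↦ by rw [hvw]
  have hrank : finrank ℝ (TangentSpace I x) = finrank ℝ (TangentSpace I x →L[ℝ] ℝ) := by
    rw [← (LinearMap.toContinuousLinearMap (𝕜 := ℝ) (E := TangentSpace I x) (F' := ℝ)).finrank_eq]
    exact (Subspace.dual_finrank_eq (K := ℝ) (V := TangentSpace I x)).symm
  have hfd' : FiniteDimensional ℝ (TangentSpace I x →L[ℝ] ℝ) :=
    (LinearMap.toContinuousLinearMap (𝕜 := ℝ) (E := TangentSpace I x) (F' := ℝ)).finiteDimensional
  exact ⟨(LinearEquiv.ofInjectiveOfFinrankEq (g.inner x).toLinearMap hinj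
    hrank).toContinuousLinearEquiv, by ext v w; rfl⟩

open scoped Classical in
/-- The Levi-Civita connection on vector fields `Y`: `∇_X Y` at `x` is the vector representing
the linear form `W ↦ koszul g X Y W x` (and `0` if `Y` is not differentiable at `x`). -/
def leviCivitaFun (g : Metric I M) (Y : Π x : M, TangentSpace I x) (x : M) :
    TangentSpace I x →L[ℝ] TangentSpace I x :=
  if hY : MDiffAt (T% Y) x then
    (g.inner x).inverse ∘L TensorialAt.mkHom₂ (fun X W ↦ koszul g X Y W x) x
      (fun _ hW ↦ koszul_tensorial_left g hY hW) (fun _ hX ↦ koszul_tensorial_right g hX hY)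
  else 0

lemma inner_leviCivitaFun (g : Metric I M) {X Y W : Π x : M, TangentSpace I x} {x : M}
    (hX : MDiffAt (T% X) x) (hY : MDiffAt (T% Y) x) (hW : MDiffAt (T% W) x) :
    g.inner x (leviCivitaFun g Y x (X x)) (W x) = koszul g X Y W x := by
  rw [leviCivitaFun, dif_pos hY, ContinuousLinearMap.comp_apply,
    (g.isInvertible_inner x).self_apply_inverse]
  exact TensorialAt.mkHom₂_apply _ _ hX hW

lemma leviCivitaFun_eq_of_koszul (g : Metric I M) {Y : Π x : M, TangentSpace I x} {x : M}
    (hY : MDiffAt (T% Y) x) {A : TangentSpace I x →L[ℝ] TangentSpace I x}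
    (h : ∀ X W : Π x : M, TangentSpace I x, MDiffAt (T% X) x → MDiffAt (T% W) x →
      koszul g X Y W x = g.inner x (A (X x)) (W x)) :
    leviCivitaFun g Y x = A := by
  ext v
  refine g.eq_of_inner_eq fun w ↦ ?_
  have hv := FiberBundle.mdifferentiableAt_extend I E v
  have hw := FiberBundle.mdifferentiableAt_extend I E w
  have h1 := inner_leviCivitaFun g hv hY hw
  rw [h _ _ hv hw] at h1
  simpa using h1

/-- The Levi-Civita connection of `g`; `leviCivita g Y x v` is `∇_v Y`. -/
def leviCivita (g : Metric I M) : CovariantDerivative I E (fun x : M ↦ TangentSpace I x) where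
  toFun := leviCivitaFun g
  isCovariantDerivativeOnUniv :=
    { add := by
        intro Y Y' x hY hY' _
        have := FiniteDimensional.complete ℝ E
        refine leviCivitaFun_eq_of_koszul g (mdifferentiableAt_add_section hY hY')
          fun X W hX hW ↦ ?_
        rw [add_apply, map_add, add_apply,
          inner_leviCivitaFun g hX hY hW, inner_leviCivitaFun g hX hY' hW]
        have h1 : (fun y ↦ g.inner y ((Y + Y') y) (W y)) =
            fun y ↦ g.inner y (Y y) (W y) + g.inner y (Y' y) (W y) := by
          ext y; simp
        have h2 : (fun y ↦ g.inner y (X y) ((Y + Y') y)) =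
            fun y ↦ g.inner y (X y) (Y y) + g.inner y (X y) (Y' y) := by
          ext y; simp
        simp only [koszul]
        rw [h1, h2, mvfderiv_fun_add (g.mdifferentiableAt_apply hY hW)
            (g.mdifferentiableAt_apply hY' hW),
          mvfderiv_fun_add (g.mdifferentiableAt_apply hX hY) (g.mdifferentiableAt_apply hX hY'),
          VectorField.mlieBracket_add_right hY hY', VectorField.mlieBracket_add_left hY hY']
        simp
        ring
      leibniz := by
        intro Y f x hY hf _
        have := FiniteDimensional.complete ℝ E
        refine leviCivitaFun_eq_of_koszul g (hf.smul_section hY) fun X W hX hW ↦ ?_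
        rw [add_apply, map_add, add_apply,
          smul_apply, map_smul, smul_apply,
          inner_leviCivitaFun g hX hY hW]
        have h1 : (fun y ↦ g.inner y ((f • Y) y) (W y)) =
            fun y ↦ f y * g.inner y (Y y) (W y) := by
          ext y; simp
        have h2 : (fun y ↦ g.inner y (X y) ((f • Y) y)) =
            fun y ↦ f y * g.inner y (X y) (Y y) := by
          ext y; simp
        simp only [koszul]
        rw [h1, h2, mvfderiv_fun_mul hf (g.mdifferentiableAt_apply hY hW),
          mvfderiv_fun_mul hf (g.mdifferentiableAt_apply hX hY),
          VectorField.mlieBracket_smul_right hf hY, VectorField.mlieBracket_smul_left hf hY]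
        simp [g.symm x (X x) (Y x)]
        ring }

lemma leviCivita_torsion_free (g : Metric I M) {X Y : Π x : M, TangentSpace I x} {x : M}
    (hX : MDiffAt (T% X) x) (hY : MDiffAt (T% Y) x) :
    leviCivita g Y x (X x) - leviCivita g X x (Y x) = VectorField.mlieBracket I X Y x := by
  refine g.eq_of_inner_eq fun w ↦ ?_
  have hw := FiberBundle.mdifferentiableAt_extend I E w
  have h1 := inner_leviCivitaFun g hX hY hw
  have h2 := inner_leviCivitaFun g hY hX hw
  simp only [FiberBundle.extend_apply_self, koszul] at h1 h2
  rw [map_sub, sub_apply]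
  change g.inner x (leviCivitaFun g Y x (X x)) w - g.inner x (leviCivitaFun g X x (Y x)) w = _
  rw [h1, h2, VectorField.mlieBracket_swap_apply (V := Y) (W := X),
    VectorField.mlieBracket_swap_apply (V := FiberBundle.extend E w) (W := X),
    VectorField.mlieBracket_swap_apply (V := FiberBundle.extend E w) (W := Y)]
  have e1 : ∀ (A B : Π x : M, TangentSpace I x),
      (fun y ↦ g.inner y (A y) (B y)) = fun y ↦ g.inner y (B y) (A y) := fun A B ↦ by
    ext y; exact g.symm y _ _
  rw [e1 Y X, e1 (FiberBundle.extend E w) X, e1 (FiberBundle.extend E w) Y]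
  simp only [map_neg, neg_apply]
  ring

lemma leviCivita_metric (g : Metric I M) {X Y W : Π x : M, TangentSpace I x} {x : M}
    (hX : MDiffAt (T% X) x) (hY : MDiffAt (T% Y) x) (hW : MDiffAt (T% W) x) :
    d% (fun y ↦ g.inner y (Y y) (W y)) x (X x) =
      g.inner x (leviCivita g Y x (X x)) (W x) + g.inner x (Y x) (leviCivita g W x (X x)) := by
  rw [g.symm x (Y x)]
  change _ = g.inner x (leviCivitaFun g Y x (X x)) (W x)
    + g.inner x (leviCivitaFun g W x (X x)) (Y x)
  rw [inner_leviCivitaFun g hX hY hW, inner_leviCivitaFun g hX hW hY]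
  have e1 : ∀ (A B : Π x : M, TangentSpace I x),
      (fun y ↦ g.inner y (A y) (B y)) = fun y ↦ g.inner y (B y) (A y) := fun A B ↦ by
    ext y; exact g.symm y _ _
  simp only [koszul]
  rw [e1 W Y, e1 X Y, e1 X W, VectorField.mlieBracket_swap_apply (V := W) (W := X),
    VectorField.mlieBracket_swap_apply (V := Y) (W := X),
    VectorField.mlieBracket_swap_apply (V := W) (W := Y)]
  simp only [map_neg, neg_apply]
  ring

/-- `(∇_Z T) X = ∇_Z (T X) - T (∇_Z X)` for a field `T` of endomorphisms. -/
def covEndo (g : Metric I M) (Z : Π x : M, TangentSpace I x)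
    (T : Π x : M, TangentSpace I x →L[ℝ] TangentSpace I x)
    (X : Π x : M, TangentSpace I x) (x : M) : TangentSpace I x :=
  leviCivita g (fun y ↦ T y (X y)) x (Z x) - T x (leviCivita g X x (Z x))

/-- The curvature `R_{XY} W = ∇_X ∇_Y W - ∇_Y ∇_X W - ∇_{[X,Y]} W`. -/
def curvature (g : Metric I M) (X Y W : Π x : M, TangentSpace I x) (x : M) :
    TangentSpace I x :=
  leviCivita g (fun y ↦ leviCivita g W y (Y y)) x (X x)
    - leviCivita g (fun y ↦ leviCivita g W y (X y)) x (Y x)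
    - leviCivita g W x (VectorField.mlieBracket I X Y x)

/-! ### Metric contact pairs -/

/-- `(α₁, α₂)` is a contact pair of type `(h, k)`: `α₁ ∧ (dα₁)^h ∧ α₂ ∧ (dα₂)^k` is a volume form
(a nowhere vanishing form of top degree), `(dα₁)^(h+1) = 0` and `(dα₂)^(k+1) = 0`. -/
structure IsContactPair (h k : ℕ) (α₁ α₂ : OneForm I M) : Prop where
  finrank_eq : finrank ℝ E = 2 * h + 2 * k + 2
  volume_ne_zero : ∀ x : M,
    wedge (wedge (wedge (altOne α₁ x) (wedgePow (altTwo α₁ x) h)) (altOne α₂ x))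
      (wedgePow (altTwo α₂ x) k) ≠ 0
  pow_eq_zero₁ : ∀ x : M, wedgePow (altTwo α₁ x) (h + 1) = 0
  pow_eq_zero₂ : ∀ x : M, wedgePow (altTwo α₂ x) (k + 1) = 0

/-- `Z₁, Z₂` are the Reeb vector fields of `(α₁, α₂)`. -/
structure IsReebPair (α₁ α₂ : OneForm I M) (Z₁ Z₂ : VField I M) : Prop where
  apply₁₁ : ∀ x, α₁ x (Z₁ x) = 1
  apply₂₂ : ∀ x, α₂ x (Z₂ x) = 1
  apply₁₂ : ∀ x, α₁ x (Z₂ x) = 0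
  apply₂₁ : ∀ x, α₂ x (Z₁ x) = 0
  contract₁₁ : ∀ x, extDer α₁ x (Z₁ x) = 0
  contract₂₁ : ∀ x, extDer α₂ x (Z₁ x) = 0
  contract₁₂ : ∀ x, extDer α₁ x (Z₂ x) = 0
  contract₂₂ : ∀ x, extDer α₂ x (Z₂ x) = 0

/-- The tangent space `ker α ∩ ker dα` at `x` of the characteristic foliation of `α`. -/
def charSpace (α : OneForm I M) (x : M) : Set (TangentSpace I x) :=
  {v | α x v = 0 ∧ extDer α x v = 0}

variable (I M) in
/-- A metric contact pair `(α₁, α₂, φ, g)` of type `(h, k)` on `M`, with its Reeb vector fields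
`Z₁, Z₂`: a contact pair structure `(α₁, α₂, φ)` and an associated metric `g`. -/
structure MetricContactPair (h k : ℕ) where
  α₁ : OneForm I M
  α₂ : OneForm I M
  φ : EndoField I M
  g : Metric I M
  Z₁ : VField I M
  Z₂ : VField I M
  isContactPair : IsContactPair h k α₁ α₂
  isReebPair : IsReebPair α₁ α₂ Z₁ Z₂
  φ_sq : ∀ (x : M) (v : TangentSpace I x),
    φ x (φ x v) = - v + α₁ x v • Z₁ x + α₂ x v • Z₂ x
  φ_Z₁ : ∀ x, φ x (Z₁ x) = 0
  φ_Z₂ : ∀ x, φ x (Z₂ x) = 0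
  inner_φ : ∀ (x : M) (v w : TangentSpace I x),
    g.inner x v (φ x w) = extDer α₁ x v w + extDer α₂ x v w
  inner_Z₁ : ∀ (x : M) (v : TangentSpace I x), g.inner x v (Z₁ x) = α₁ x v
  inner_Z₂ : ∀ (x : M) (v : TangentSpace I x), g.inner x v (Z₂ x) = α₂ x v

namespace MetricContactPair

variable {h k : ℕ} (S : MetricContactPair I M h k)

/-- `φ` is decomposable: it maps the tangent spaces of both characteristic foliations into
themselves. -/
def IsDecomposable : Prop :=
  ∀ x : M, Set.MapsTo (S.φ x) (charSpace S.α₁ x) (charSpace S.α₁ x) ∧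
    Set.MapsTo (S.φ x) (charSpace S.α₂ x) (charSpace S.α₂ x)

/-- `Z = Z₁ + Z₂`. -/
def Z : VField I M := S.Z₁.add S.Z₂

/-- The tensor field `h = (1/2) L_Z φ`. -/
def hTensor (x : M) : TangentSpace I x →L[ℝ] TangentSpace I x :=
  (1 / 2 : ℝ) • lieDerEndo S.Z S.φ x

end MetricContactPair

end

end ContactPairs

/-!
With `η = α₁ + α₂`, the field `Z` is the metric dual of `η`, and `dη(X, Y) = g(X, φ Y)`. The idea
is to express the operator `A = ∇Z` through `φ` and `h`, as for the Reeb field of a contact metric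
structure, and then to differentiate once more along `Z`.

* Since `i_V dαᵢ = 0` and `αᵢ(V)` is constant for `V = Z₁, Z₂, Z`, the forms `αᵢ` and `dαᵢ` are
  invariant under these fields (`mvfderiv_oneForm_apply`, `mvfderiv_extDer_apply`). Invariance of
  `dαᵢ` amounts to `d(dαᵢ) = 0`; it follows from the Jacobi identity and from
  `[X, Y] f = X (Y f) - Y (X f)`, itself a consequence of the Jacobi identity
  (`mvfderiv_mlieBracket`).
* Consequently `[Z₁, Z₂] = 0`, and `A Zᵢ = ∇_Z Zᵢ = 0`; in particular `Z` is geodesic.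
* The skew-symmetric part of `A` is `-φ` (`inner_leviCivita_Z_sub`), and invariance of `dη` under
  `Z` determines the symmetric part from `h` (`two_mul_inner_hTensor`). Together with
  `h φ = - φ h` (`hTensor_φ`) this gives `A = -φ - φ h` (`leviCivita_Z`). The commutator of `φ` and
  `A` is then `2 h = L_Z φ`, so that `∇_Z φ = 0` (`leviCivita_φ_apply_Z`).
* From `R(X, Z) Z = -(∇_Z A) X - A² X` one gets `R(X, Z) Z = φ (∇_Z h) X - φ² X - h² X`
  (`curvature_Z_Z`). Applying `φ` gives the first identity, because `∇_Z h` takes values in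
  `ker α₁ ∩ ker α₂`, where `φ² = -Id`. The second one follows by comparing the formula at `X` with
  the formula at `φ X`, since both `h` and `∇_Z h` anticommute with `φ`.

Vector fields prescribed at a point are only taken to be `C²` near that point; this suffices for
tensorial identities and requires no cutoff functions.
-/

namespace ContactPairs

variable {E : Type*} [NormedAddCommGroup E] [NormedSpace ℝ E]
  {H : Type*} [TopologicalSpace H] {I : ModelWithCorners ℝ E H}
  {M : Type*} [TopologicalSpace M] [ChartedSpace H M] [IsManifold I ∞ M]

/-! ### Second order calculus of vector fields near a point -/

section Calculus

lemma mvfderiv_congr {E : Type*} [NormedAddCommGroup E] [NormedSpace ℝ E] {H : Type*}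
    [TopologicalSpace H] {I : ModelWithCorners ℝ E H} {M : Type*} [TopologicalSpace M]
    [ChartedSpace H M] {x : M} {f f' : M → ℝ} (h : f =ᶠ[nhds x] f') : d% f x = d% f' x := by
  ext v
  exact DFunLike.congr_fun h.mfderiv_eq v

variable {X Y W : Π x : M, TangentSpace I x} {f : M → ℝ} {x : M}

lemma two_le_infty : (2 : ℕ∞ω) ≤ ∞ := by
  change ((2 : ℕ∞) : ℕ∞ω) ≤ ((⊤ : ℕ∞) : ℕ∞ω)
  exact WithTop.coe_le_coe.2 le_top

lemma isManifold_three : IsManifold I 3 M :=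
  IsManifold.of_le (n := ∞) <| by
    change ((3 : ℕ∞) : ℕ∞ω) ≤ ((⊤ : ℕ∞) : ℕ∞ω)
    exact WithTop.coe_le_coe.2 le_top

lemma VField.contMDiffAt_two (X : VField I M) (x : M) : CMDiffAt 2 (T% X.toFun) x :=
  (X.contMDiff x).of_le two_le_infty

lemma OneForm.contMDiffAt_apply (α : OneForm I M) (hX : CMDiffAt 2 (T% X) x) :
    CMDiffAt 2 (fun y ↦ α y (X y)) x := by
  have h := (ContMDiffAt.of_le (α.contMDiff x) two_le_infty).clm_bundle_apply hX
  rw [contMDiffAt_totalSpace] at h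
  exact h.2

lemma EndoField.contMDiffAt_apply (φ : EndoField I M) (hX : CMDiffAt 2 (T% X) x) :
    CMDiffAt 2 (T% (fun y ↦ φ y (X y))) x :=
  (ContMDiffAt.of_le (φ.contMDiff x) two_le_infty).clm_bundle_apply hX

lemma eventually_mdifferentiableAt_section (hX : CMDiffAt 2 (T% X) x) :
    ∀ᶠ y in nhds x, MDiffAt (T% X) y := by
  have : IsManifold I (2 + 1) M := isManifold_three
  filter_upwards [(contMDiffAt_iff_contMDiffAt_nhds (by simp)).1 hX] with y hy
  exact hy.mdifferentiableAt (by simp)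

lemma eventually_mdifferentiableAt (hf : CMDiffAt 2 f x) : ∀ᶠ y in nhds x, MDiffAt f y := by
  have : IsManifold I 2 M := IsManifold.of_le two_le_infty
  filter_upwards [(contMDiffAt_iff_contMDiffAt_nhds (by simp)).1 hf] with y hy
  exact hy.mdifferentiableAt (by simp)

variable [FiniteDimensional ℝ E]

lemma contMDiffAt_mlieBracket (hX : CMDiffAt 2 (T% X) x) (hY : CMDiffAt 2 (T% Y) x) :
    CMDiffAt 1 (T% (VectorField.mlieBracket I X Y)) x := by
  have := FiniteDimensional.complete ℝ E
  have : IsManifold I (minSmoothness ℝ 2) M := by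
    rw [minSmoothness_of_isRCLikeNormedField]
    exact IsManifold.of_le (n := ∞) two_le_infty
  have : IsManifold I (((2 : ℕ∞) : ℕ∞ω) + 1) M := isManifold_three
  refine ContMDiffAt.mlieBracket_vectorField (m := 1) (n := 2) hX hY ?_
  simp only [minSmoothness_of_isRCLikeNormedField]
  exact_mod_cast le_of_eq (by norm_num)

lemma mdifferentiableAt_mlieBracket (hX : CMDiffAt 2 (T% X) x) (hY : CMDiffAt 2 (T% Y) x) :
    MDiffAt (T% (VectorField.mlieBracket I X Y)) x :=
  (contMDiffAt_mlieBracket hX hY).mdifferentiableAt (by simp)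

lemma mlieBracket_jacobi (hX : CMDiffAt 2 (T% X) x) (hY : CMDiffAt 2 (T% Y) x)
    (hW : CMDiffAt 2 (T% W) x) :
    VectorField.mlieBracket I X (VectorField.mlieBracket I Y W) x =
      VectorField.mlieBracket I (VectorField.mlieBracket I X Y) W x
        + VectorField.mlieBracket I Y (VectorField.mlieBracket I X W) x := by
  have := FiniteDimensional.complete ℝ E
  have h3 : minSmoothness ℝ 3 = 3 := minSmoothness_of_isRCLikeNormedField
  have h2 : minSmoothness ℝ 2 = 2 := minSmoothness_of_isRCLikeNormedField
  have : IsManifold I (minSmoothness ℝ 3) M := by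
    rw [h3]
    exact isManifold_three
  apply VectorField.leibniz_identity_mlieBracket_apply <;> rwa [h2]

lemma mlieBracket_smul_eventuallyEq (hf : CMDiffAt 2 f x) (W : VField I M) :
    VectorField.mlieBracket I Y (f • W.toFun) =ᶠ[nhds x]
      (fun y ↦ d% f y (Y y)) • W.toFun + f • VectorField.mlieBracket I Y W.toFun := by
  have := FiniteDimensional.complete ℝ E
  filter_upwards [eventually_mdifferentiableAt hf] with y hy
  exact VectorField.mlieBracket_smul_right hy (W.mdifferentiableAt y)

/-- The coefficient of `W` in `[Y, f W]` is the derivative of `f` along `Y`, which is therefore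
differentiable because the bracket is. -/
lemma mdifferentiableAt_mvfderiv_apply (hf : CMDiffAt 2 f x) (hY : CMDiffAt 2 (T% Y) x)
    (β : OneForm I M) (W : VField I M) (hβ : ∀ y, β y (W y) = 1) :
    MDiffAt (fun y ↦ d% f y (Y y)) x := by
  have h1 : MDiffAt (fun y ↦ β y (VectorField.mlieBracket I Y (f • W.toFun) y)
      - f y * β y (VectorField.mlieBracket I Y W.toFun y)) x :=
    (β.mdifferentiableAt_apply (mdifferentiableAt_mlieBracket hY
      (hf.smul_section (W.contMDiffAt_two x)))).sub
      ((hf.mdifferentiableAt (by simp)).mul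
        (β.mdifferentiableAt_apply (mdifferentiableAt_mlieBracket hY (W.contMDiffAt_two x))))
  refine h1.congr_of_eventuallyEq ?_
  filter_upwards [mlieBracket_smul_eventuallyEq (Y := Y) hf W] with y hy
  rw [hy]
  simp [hβ]

/-- `[X, Y] f = X (Y f) - Y (X f)`: the Jacobi identity for `X`, `Y`, `f W`, read off in the
direction of a nowhere vanishing field `W`. -/
theorem mvfderiv_mlieBracket (hf : CMDiffAt 2 f x) (hX : CMDiffAt 2 (T% X) x)
    (hY : CMDiffAt 2 (T% Y) x) (β : OneForm I M) (W : VField I M) (hβ : ∀ y, β y (W y) = 1) :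
    d% f x (VectorField.mlieBracket I X Y x) =
      d% (fun y ↦ d% f y (Y y)) x (X x) - d% (fun y ↦ d% f y (X y)) x (Y x) := by
  have := FiniteDimensional.complete ℝ E
  have hW := W.contMDiffAt_two x
  have hWd := W.mdifferentiableAt x
  have hfd : MDiffAt f x := hf.mdifferentiableAt (by simp)
  have key : ∀ {X Y : Π x : M, TangentSpace I x}, CMDiffAt 2 (T% Y) x →
      VectorField.mlieBracket I X (VectorField.mlieBracket I Y (f • W.toFun)) x =
        (d% (fun y ↦ d% f y (Y y)) x (X x) • W x
          + d% f x (Y x) • VectorField.mlieBracket I X W.toFun x)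
        + (d% f x (X x) • VectorField.mlieBracket I Y W.toFun x
          + f x • VectorField.mlieBracket I X (VectorField.mlieBracket I Y W.toFun) x) := by
    intro X Y hY
    have hYf := mdifferentiableAt_mvfderiv_apply hf hY β W hβ
    have hYW := mdifferentiableAt_mlieBracket hY hW
    refine (Filter.EventuallyEq.mlieBracket_vectorField_eq Filter.EventuallyEq.rfl
      (mlieBracket_smul_eventuallyEq (Y := Y) hf W)).trans ?_
    rw [VectorField.mlieBracket_add_right (hYf.smul_section hWd) (hfd.smul_section hYW),
      VectorField.mlieBracket_smul_right hYf hWd, VectorField.mlieBracket_smul_right hfd hYW]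
  have hJ := mlieBracket_jacobi hX hY (hf.smul_section hW)
  rw [key hY, key hX, VectorField.mlieBracket_smul_right hfd hWd, mlieBracket_jacobi hX hY hW] at hJ
  have := congrArg (β x) hJ
  simp only [map_add, map_smul, smul_eq_mul, hβ] at this
  linarith

end Calculus

/-! ### Invariance of a one-form and of its differential -/

section Invariance

variable [FiniteDimensional ℝ E]
variable {Y W : Π x : M, TangentSpace I x} {x : M}

/-- A field `Z` with `α(Z)` constant and `i_Z dα = 0` satisfies `L_Z α = 0`. -/
lemma mvfderiv_oneForm_apply (α : OneForm I M) (Z : VField I M) {c : ℝ} (hc : ∀ y, α y (Z y) = c)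
    (hZ : ∀ y, extDer α y (Z y) = 0) (hY : MDiffAt (T% Y) x) :
    d% (fun y ↦ α y (Y y)) x (Z x) = α x (VectorField.mlieBracket I Z Y x) := by
  have h := extDer_apply α (Z.mdifferentiableAt x) hY
  simp only [hZ, hc, mvfderiv_const] at h
  simp only [zero_apply] at h
  linarith

lemma extDer_apply_eventuallyEq (α : OneForm I M) (hY : CMDiffAt 2 (T% Y) x)
    (hW : CMDiffAt 2 (T% W) x) :
    (fun y ↦ extDer α y (Y y) (W y)) =ᶠ[nhds x] fun y ↦
      (1 / 2 : ℝ) * (d% (fun z ↦ α z (W z)) y (Y y) - d% (fun z ↦ α z (Y z)) y (W y)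
        - α y (VectorField.mlieBracket I Y W y)) := by
  filter_upwards [eventually_mdifferentiableAt_section hY,
    eventually_mdifferentiableAt_section hW] with y hy hw
  exact extDer_apply α hy hw

lemma mdifferentiableAt_extDer_apply (α β : OneForm I M) (T : VField I M)
    (hβ : ∀ y, β y (T y) = 1) (hY : CMDiffAt 2 (T% Y) x) (hW : CMDiffAt 2 (T% W) x) :
    MDiffAt (fun y ↦ extDer α y (Y y) (W y)) x := by
  have h : MDiffAt (fun y ↦
      (1 / 2 : ℝ) * (d% (fun z ↦ α z (W z)) y (Y y) - d% (fun z ↦ α z (Y z)) y (W y)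
        - α y (VectorField.mlieBracket I Y W y))) x :=
    mdifferentiableAt_const.mul
      (((mdifferentiableAt_mvfderiv_apply (α.contMDiffAt_apply hW) hY β T hβ).sub
        (mdifferentiableAt_mvfderiv_apply (α.contMDiffAt_apply hY) hW β T hβ)).sub
        (α.mdifferentiableAt_apply (mdifferentiableAt_mlieBracket hY hW)))
  exact h.congr_of_eventuallyEq (extDer_apply_eventuallyEq α hY hW)

/-- A field `Z` with `α(Z)` constant and `i_Z dα = 0` satisfies `L_Z dα = 0`. The pair `β`, `T`
only serves as the nowhere vanishing field required by `mvfderiv_mlieBracket`. -/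
theorem mvfderiv_extDer_apply (α : OneForm I M) (Z : VField I M) {c : ℝ}
    (hc : ∀ y, α y (Z y) = c) (hZ : ∀ y, extDer α y (Z y) = 0)
    (β : OneForm I M) (T : VField I M) (hβ : ∀ y, β y (T y) = 1)
    (hY : CMDiffAt 2 (T% Y) x) (hW : CMDiffAt 2 (T% W) x) :
    d% (fun y ↦ extDer α y (Y y) (W y)) x (Z x) =
      extDer α x (VectorField.mlieBracket I Z Y x) (W x)
        + extDer α x (Y x) (VectorField.mlieBracket I Z W x) := by
  have hZ2 := Z.contMDiffAt_two x
  have hYd : MDiffAt (T% Y) x := hY.mdifferentiableAt (by simp)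
  have hWd : MDiffAt (T% W) x := hW.mdifferentiableAt (by simp)
  have hZY := mdifferentiableAt_mlieBracket hZ2 hY
  have hZW := mdifferentiableAt_mlieBracket hZ2 hW
  have hYW := mdifferentiableAt_mlieBracket hY hW
  have hαY := α.contMDiffAt_apply hY
  have hαW := α.contMDiffAt_apply hW
  have dYW := mdifferentiableAt_mvfderiv_apply hαW hY β T hβ
  have dWY := mdifferentiableAt_mvfderiv_apply hαY hW β T hβ
  have e2 : ∀ {V : Π x : M, TangentSpace I x}, CMDiffAt 2 (T% V) x →
      (fun y ↦ d% (fun z ↦ α z (V z)) y (Z y)) =ᶠ[nhds x]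
        fun y ↦ α y (VectorField.mlieBracket I Z V y) := by
    intro V hV
    filter_upwards [eventually_mdifferentiableAt_section hV] with y hy
    exact mvfderiv_oneForm_apply α Z hc hZ hy
  have cYW := mvfderiv_mlieBracket hαW hZ2 hY β T hβ
  have cWY := mvfderiv_mlieBracket hαY hZ2 hW β T hβ
  rw [mvfderiv_congr (e2 hW)] at cYW
  rw [mvfderiv_congr (e2 hY)] at cWY
  have hd0 : MDiffAt (fun y ↦ d% (fun z ↦ α z (W z)) y (Y y)
      - d% (fun z ↦ α z (Y z)) y (W y)) x := dYW.sub dWY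
  have hd : MDiffAt (fun y ↦ d% (fun z ↦ α z (W z)) y (Y y) - d% (fun z ↦ α z (Y z)) y (W y)
      - α y (VectorField.mlieBracket I Y W y)) x :=
    hd0.sub (α.mdifferentiableAt_apply hYW)
  have hJ := congrArg (α x) (mlieBracket_jacobi hZ2 hY hW)
  rw [map_add] at hJ
  rw [extDer_apply α hZY hWd, extDer_apply α hYd hZW,
    mvfderiv_congr (extDer_apply_eventuallyEq α hY hW),
    mvfderiv_fun_mul mdifferentiableAt_const hd,
    mvfderiv_fun_sub hd0 (α.mdifferentiableAt_apply hYW), mvfderiv_fun_sub dYW dWY]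
  have hL := mvfderiv_oneForm_apply α Z hc hZ hYW
  simp only [add_apply, sub_apply, smul_apply, mvfderiv_const, zero_apply, smul_eq_mul, hL]
  linarith

end Invariance

/-! ### The tensors of a metric contact pair -/

namespace MetricContactPair

variable [FiniteDimensional ℝ E] {h k : ℕ} (S : MetricContactPair I M h k)
  {X : Π x : M, TangentSpace I x} {x : M}

lemma inner_Z (x : M) (v : TangentSpace I x) : S.g.inner x v (S.Z x) = S.α₁ x v + S.α₂ x v := by
  change S.g.inner x v (S.Z₁ x + S.Z₂ x) = _
  rw [map_add, S.inner_Z₁, S.inner_Z₂]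

lemma α₁_Z (x : M) : S.α₁ x (S.Z x) = 1 := by
  change S.α₁ x (S.Z₁ x + S.Z₂ x) = _
  rw [map_add, S.isReebPair.apply₁₁, S.isReebPair.apply₁₂, add_zero]

lemma α₂_Z (x : M) : S.α₂ x (S.Z x) = 1 := by
  change S.α₂ x (S.Z₁ x + S.Z₂ x) = _
  rw [map_add, S.isReebPair.apply₂₁, S.isReebPair.apply₂₂, zero_add]

lemma extDer_α₁_Z (x : M) : extDer S.α₁ x (S.Z x) = 0 := by
  change extDer S.α₁ x (S.Z₁ x + S.Z₂ x) = _
  rw [map_add, S.isReebPair.contract₁₁, S.isReebPair.contract₁₂, add_zero]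

lemma extDer_α₂_Z (x : M) : extDer S.α₂ x (S.Z x) = 0 := by
  change extDer S.α₂ x (S.Z₁ x + S.Z₂ x) = _
  rw [map_add, S.isReebPair.contract₂₁, S.isReebPair.contract₂₂, add_zero]

lemma φ_Z (x : M) : S.φ x (S.Z x) = 0 := by
  change S.φ x (S.Z₁ x + S.Z₂ x) = _
  rw [map_add, S.φ_Z₁, S.φ_Z₂, add_zero]

lemma α₁_φ (x : M) (v : TangentSpace I x) : S.α₁ x (S.φ x v) = 0 := by
  rw [← S.inner_Z₁, S.g.symm, S.inner_φ, S.isReebPair.contract₁₁, S.isReebPair.contract₂₁]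
  simp

lemma α₂_φ (x : M) (v : TangentSpace I x) : S.α₂ x (S.φ x v) = 0 := by
  rw [← S.inner_Z₂, S.g.symm, S.inner_φ, S.isReebPair.contract₁₂, S.isReebPair.contract₂₂]
  simp

lemma φ_cube (x : M) (v : TangentSpace I x) : S.φ x (S.φ x (S.φ x v)) = - S.φ x v := by
  rw [S.φ_sq, S.α₁_φ, S.α₂_φ]
  simp

/-- The Reeb fields commute: `[Z₁, Z₂]` is annihilated by `α₁`, `α₂`, `dα₁`, `dα₂`. -/
lemma mlieBracket_Z₁_Z₂ (x : M) : VectorField.mlieBracket I S.Z₁ S.Z₂ x = 0 := by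
  have R := S.isReebPair
  have hZ₂ := S.Z₂.contMDiffAt_two x
  have a₁ : S.α₁ x (VectorField.mlieBracket I S.Z₁ S.Z₂ x) = 0 := by
    rw [← mvfderiv_oneForm_apply S.α₁ S.Z₁ R.apply₁₁ R.contract₁₁ (S.Z₂.mdifferentiableAt x)]
    simp only [R.apply₁₂, mvfderiv_const, zero_apply]
  have a₂ : S.α₂ x (VectorField.mlieBracket I S.Z₁ S.Z₂ x) = 0 := by
    rw [← mvfderiv_oneForm_apply S.α₂ S.Z₁ R.apply₂₁ R.contract₂₁ (S.Z₂.mdifferentiableAt x)]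
    simp only [R.apply₂₂, mvfderiv_const, zero_apply]
  have hd : ∀ w, S.g.inner x (VectorField.mlieBracket I S.Z₁ S.Z₂ x) (S.φ x w) = 0 := by
    intro w
    have hw : CMDiffAt 2 (T% (FiberBundle.extend E w)) x :=
      (FiberBundle.contMDiffAt_extend (k := ∞) I E w).of_le two_le_infty
    have d₁ := mvfderiv_extDer_apply S.α₁ S.Z₁ R.apply₁₁ R.contract₁₁ S.α₁ S.Z₁ R.apply₁₁ hZ₂ hw
    have d₂ := mvfderiv_extDer_apply S.α₂ S.Z₁ R.apply₂₁ R.contract₂₁ S.α₁ S.Z₁ R.apply₁₁ hZ₂ hw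
    simp only [R.contract₁₂, R.contract₂₂, zero_apply, mvfderiv_const,
      FiberBundle.extend_apply_self, add_zero] at d₁ d₂
    rw [S.inner_φ, ← d₁, ← d₂, add_zero]
  refine S.g.eq_of_inner_eq fun u ↦ ?_
  have hu : u = - S.φ x (S.φ x u) + S.α₁ x u • S.Z₁ x + S.α₂ x u • S.Z₂ x := by
    rw [S.φ_sq]; module
  rw [hu]
  simp only [map_add, map_neg, map_smul, hd, S.inner_Z₁, S.inner_Z₂, a₁, a₂]
  simp

lemma mlieBracket_Z_left (X : Π x : M, TangentSpace I x) (x : M) :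
    VectorField.mlieBracket I S.Z X x =
      VectorField.mlieBracket I S.Z₁ X x + VectorField.mlieBracket I S.Z₂ X x := by
  have := FiniteDimensional.complete ℝ E
  exact VectorField.mlieBracket_add_left (S.Z₁.mdifferentiableAt x) (S.Z₂.mdifferentiableAt x)

lemma mlieBracket_Z_Z₁ (x : M) : VectorField.mlieBracket I S.Z S.Z₁ x = 0 := by
  rw [S.mlieBracket_Z_left S.Z₁ x,
    VectorField.mlieBracket_swap_apply (V := S.Z₂.toFun), S.mlieBracket_Z₁_Z₂]
  simp

lemma mlieBracket_Z_Z₂ (x : M) : VectorField.mlieBracket I S.Z S.Z₂ x = 0 := by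
  rw [S.mlieBracket_Z_left S.Z₂ x, S.mlieBracket_Z₁_Z₂]
  simp

/-- The skew-symmetric part of `∇Z` is `-φ`, since `Z` is dual to `α₁ + α₂`. -/
lemma inner_leviCivita_Z_sub (x : M) (v w : TangentSpace I x) :
    S.g.inner x (leviCivita S.g S.Z x v) w - S.g.inner x (leviCivita S.g S.Z x w) v =
      2 * S.g.inner x v (S.φ x w) := by
  have hv := FiberBundle.mdifferentiableAt_extend I E v
  have hw := FiberBundle.mdifferentiableAt_extend I E w
  have hZ := S.Z.mdifferentiableAt x
  have e : ∀ {W : Π x : M, TangentSpace I x}, MDiffAt (T% W) x →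
      d% (fun y ↦ S.g.inner y (S.Z y) (W y)) x =
        d% (fun y ↦ S.α₁ y (W y)) x + d% (fun y ↦ S.α₂ y (W y)) x := by
    intro W hW
    rw [← mvfderiv_fun_add (S.α₁.mdifferentiableAt_apply hW) (S.α₂.mdifferentiableAt_apply hW)]
    congr 1
    ext y
    rw [S.g.symm, S.inner_Z]
  have d₁ := extDer_apply S.α₁ hv hw
  have d₂ := extDer_apply S.α₂ hv hw
  have m₁ := leviCivita_metric S.g hv hZ hw
  have m₂ := leviCivita_metric S.g hw hZ hv
  have t := congrArg (S.g.inner x (S.Z x)) (leviCivita_torsion_free S.g hv hw)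
  rw [S.g.symm x (S.Z x) (VectorField.mlieBracket _ _ _ _), S.inner_Z, map_sub] at t
  rw [e hw, add_apply] at m₁
  rw [e hv, add_apply] at m₂
  simp only [FiberBundle.extend_apply_self] at d₁ d₂ m₁ m₂ t
  rw [S.inner_φ, d₁, d₂]
  linarith

/-- Let `T` be dual to a form `α` and commute with `Z`, with `L_Z α = 0` and `φ T = 0`. Invariance
of `α` gives `g(∇_T Z, w) = -g(∇_w Z, T)`, while these two numbers are equal because the
skew-symmetric part of `∇Z` kills `T`; so both vanish. -/
lemma leviCivita_Z_eq_zero_of_invariant {α : OneForm I M} {T : VField I M}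
    (hα : ∀ (x : M) (v : TangentSpace I x), S.g.inner x v (T x) = α x v)
    (hαZ : ∀ y, α y (S.Z y) = 1) (hdα : ∀ y, extDer α y (S.Z y) = 0)
    (hφ : ∀ y, S.φ y (T y) = 0) (hT : ∀ y, VectorField.mlieBracket I S.Z T y = 0) (x : M) :
    leviCivita S.g S.Z x (T x) = 0 := by
  have hZ := S.Z.mdifferentiableAt x
  refine S.g.eq_of_inner_eq fun w ↦ ?_
  have hw := FiberBundle.mdifferentiableAt_extend I E w
  have ht := leviCivita_torsion_free S.g hZ (T.mdifferentiableAt x)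
  have ht' := congrArg (S.g.inner x (T x)) (leviCivita_torsion_free S.g hZ hw)
  have hm := leviCivita_metric S.g hZ (T.mdifferentiableAt x) hw
  have hinv := mvfderiv_oneForm_apply α S.Z hαZ hdα hw
  rw [hT, sub_eq_zero] at ht
  have e : (fun y ↦ S.g.inner y (T y) (FiberBundle.extend E w y)) =
      fun y ↦ α y (FiberBundle.extend E w y) := by
    ext y
    rw [S.g.symm, hα]
  rw [e, hinv, ht] at hm
  rw [map_sub, S.g.symm x _ (VectorField.mlieBracket _ _ _ _), hα] at ht'
  have hs := S.inner_leviCivita_Z_sub x w (T x)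
  simp only [FiberBundle.extend_apply_self, hφ, map_zero, zero_apply] at hm ht' hs ⊢
  rw [S.g.symm x (T x) (leviCivita S.g S.Z x w)] at ht'
  linarith

lemma leviCivita_Z_Z₁ (x : M) : leviCivita S.g S.Z x (S.Z₁ x) = 0 :=
  S.leviCivita_Z_eq_zero_of_invariant S.inner_Z₁ S.α₁_Z S.extDer_α₁_Z S.φ_Z₁ S.mlieBracket_Z_Z₁ x

lemma leviCivita_Z_Z₂ (x : M) : leviCivita S.g S.Z x (S.Z₂ x) = 0 :=
  S.leviCivita_Z_eq_zero_of_invariant S.inner_Z₂ S.α₂_Z S.extDer_α₂_Z S.φ_Z₂ S.mlieBracket_Z_Z₂ x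

lemma leviCivita_Z_Z (x : M) : leviCivita S.g S.Z x (S.Z x) = 0 := by
  change leviCivita S.g S.Z x (S.Z₁ x + S.Z₂ x) = 0
  rw [map_add, S.leviCivita_Z_Z₁, S.leviCivita_Z_Z₂, add_zero]

lemma leviCivita_Z₁_Z (x : M) : leviCivita S.g S.Z₁ x (S.Z x) = 0 := by
  have ht := leviCivita_torsion_free S.g (S.Z.mdifferentiableAt x) (S.Z₁.mdifferentiableAt x)
  rwa [S.mlieBracket_Z_Z₁, S.leviCivita_Z_Z₁, sub_zero] at ht

lemma leviCivita_Z₂_Z (x : M) : leviCivita S.g S.Z₂ x (S.Z x) = 0 := by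
  have ht := leviCivita_torsion_free S.g (S.Z.mdifferentiableAt x) (S.Z₂.mdifferentiableAt x)
  rwa [S.mlieBracket_Z_Z₂, S.leviCivita_Z_Z₂, sub_zero] at ht

/-! ### The tensor `h` -/

lemma two_smul_hTensor_apply (hX : MDiffAt (T% X) x) : (2 : ℝ) • S.hTensor x (X x) =
    VectorField.mlieBracket I S.Z (fun y ↦ S.φ y (X y)) x
      - S.φ x (VectorField.mlieBracket I S.Z X x) := by
  rw [hTensor, smul_apply, lieDerEndo_apply S.Z S.φ hX]
  module

/-- The invariance `L_Z (dα₁ + dα₂) = 0` expressed through `L_Z g` and `L_Z φ`: the form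
`(L_Z g)(v, φ w) + 2 g(v, h w)` vanishes. -/
lemma two_mul_inner_hTensor (x : M) (v w : TangentSpace I x) :
    2 * S.g.inner x v (S.hTensor x w) =
      - (S.g.inner x (leviCivita S.g S.Z x v) (S.φ x w)
        + S.g.inner x v (leviCivita S.g S.Z x (S.φ x w))) := by
  have hv2 : CMDiffAt 2 (T% (FiberBundle.extend E v)) x :=
    (FiberBundle.contMDiffAt_extend (k := ∞) I E v).of_le two_le_infty
  have hw2 : CMDiffAt 2 (T% (FiberBundle.extend E w)) x :=
    (FiberBundle.contMDiffAt_extend (k := ∞) I E w).of_le two_le_infty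
  have hv := FiberBundle.mdifferentiableAt_extend I E v
  have hw := FiberBundle.mdifferentiableAt_extend I E w
  have hZ := S.Z.mdifferentiableAt x
  have hφw := S.φ.mdifferentiableAt_apply hw
  have R := S.isReebPair
  have d₁ := mvfderiv_extDer_apply S.α₁ S.Z S.α₁_Z S.extDer_α₁_Z S.α₁ S.Z₁ R.apply₁₁ hv2 hw2
  have d₂ := mvfderiv_extDer_apply S.α₂ S.Z S.α₂_Z S.extDer_α₂_Z S.α₁ S.Z₁ R.apply₁₁ hv2 hw2
  have e : d% (fun y ↦ S.g.inner y (FiberBundle.extend E v y)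
        (S.φ y (FiberBundle.extend E w y))) x =
      d% (fun y ↦ extDer S.α₁ y (FiberBundle.extend E v y) (FiberBundle.extend E w y)) x
        + d% (fun y ↦ extDer S.α₂ y (FiberBundle.extend E v y) (FiberBundle.extend E w y)) x := by
    rw [← mvfderiv_fun_add
      (mdifferentiableAt_extDer_apply S.α₁ S.α₁ S.Z₁ R.apply₁₁ hv2 hw2)
      (mdifferentiableAt_extDer_apply S.α₂ S.α₁ S.Z₁ R.apply₁₁ hv2 hw2)]
    congr 1
    ext y
    rw [S.inner_φ]
  have hm := leviCivita_metric S.g hZ hv hφw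
  rw [e, add_apply, d₁, d₂] at hm
  have i₁ := S.inner_φ x (VectorField.mlieBracket I S.Z (FiberBundle.extend E v) x) w
  have i₂ := S.inner_φ x v (VectorField.mlieBracket I S.Z (FiberBundle.extend E w) x)
  have hh := congrArg (S.g.inner x v) (S.two_smul_hTensor_apply hw)
  rw [← leviCivita_torsion_free S.g hZ hφw] at hh
  rw [← leviCivita_torsion_free S.g hZ hv] at i₁
  simp only [FiberBundle.extend_apply_self, map_sub, map_smul, smul_eq_mul, sub_apply]
    at hm hh i₁ i₂
  rw [← leviCivita_torsion_free S.g hZ hv] at hm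
  simp only [FiberBundle.extend_apply_self, map_sub, sub_apply] at hm
  linarith

/-- The symmetrization in `two_mul_inner_hTensor` is resolved by the formula for the skew-symmetric
part of `∇Z`. -/
lemma hTensor_eq (x : M) (w : TangentSpace I x) :
    S.hTensor x w = - leviCivita S.g S.Z x (S.φ x w) - S.φ x (S.φ x w) := by
  refine S.g.eq_of_inner_eq fun v ↦ ?_
  have h₁ := S.two_mul_inner_hTensor x v w
  have h₂ := S.inner_leviCivita_Z_sub x v (S.φ x w)
  rw [S.g.symm x v (S.hTensor x w), S.g.symm x v (leviCivita S.g S.Z x (S.φ x w))] at h₁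
  rw [S.g.symm x v (S.φ x (S.φ x w))] at h₂
  simp only [map_sub, map_neg, sub_apply, neg_apply]
  linarith

lemma hTensor_Z₁ (x : M) : S.hTensor x (S.Z₁ x) = 0 := by
  simp [S.hTensor_eq, S.φ_Z₁]

lemma hTensor_Z₂ (x : M) : S.hTensor x (S.Z₂ x) = 0 := by
  simp [S.hTensor_eq, S.φ_Z₂]

lemma hTensor_φ_sq (x : M) (v : TangentSpace I x) :
    S.hTensor x (S.φ x (S.φ x v)) = - S.hTensor x v := by
  rw [S.φ_sq]
  simp [S.hTensor_Z₁, S.hTensor_Z₂]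

/-- The formula for `h` in terms of `∇Z` is solved for `∇Z` by replacing `w` with `φ w`; no
information is lost because `∇Z` vanishes on `Z₁` and `Z₂`. -/
lemma leviCivita_Z_eq_hTensor_φ (x : M) (v : TangentSpace I x) :
    leviCivita S.g S.Z x v = - S.φ x v + S.hTensor x (S.φ x v) := by
  rw [S.hTensor_eq, S.φ_cube, S.φ_sq]
  simp [S.leviCivita_Z_Z₁, S.leviCivita_Z_Z₂]

/-- `h` anticommutes with `φ`: differentiate `φ² = -Id + α₁ ⊗ Z₁ + α₂ ⊗ Z₂` along `Z`, all
terms on the right being `Z`-invariant. -/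
lemma hTensor_φ (x : M) (v : TangentSpace I x) :
    S.hTensor x (S.φ x v) = - S.φ x (S.hTensor x v) := by
  have := FiniteDimensional.complete ℝ E
  have hv := FiberBundle.mdifferentiableAt_extend I E v
  have hφv := S.φ.mdifferentiableAt_apply hv
  have h₁ := S.two_smul_hTensor_apply hφv
  have h₂ := congrArg (S.φ x) (S.two_smul_hTensor_apply hv)
  set V := FiberBundle.extend E v with hV
  have m₁ := S.α₁.mdifferentiableAt_apply hv
  have m₂ := S.α₂.mdifferentiableAt_apply hv
  have n₁ : MDiffAt (T% ((fun y ↦ S.α₁ y (V y)) • S.Z₁.toFun)) x :=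
    m₁.smul_section (S.Z₁.mdifferentiableAt x)
  have n₂ : MDiffAt (T% ((fun y ↦ S.α₂ y (V y)) • S.Z₂.toFun)) x :=
    m₂.smul_section (S.Z₂.mdifferentiableAt x)
  have n₀ : MDiffAt (T% ((fun _ : M ↦ (-1 : ℝ)) • V)) x := mdifferentiableAt_const.smul_section hv
  have e : (fun y ↦ S.φ y (S.φ y (V y))) = (((fun _ : M ↦ (-1 : ℝ)) • V)
      + (fun y ↦ S.α₁ y (V y)) • S.Z₁.toFun) + (fun y ↦ S.α₂ y (V y)) • S.Z₂.toFun := by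
    ext y
    rw [S.φ_sq]
    simp
  rw [e, VectorField.mlieBracket_add_right (mdifferentiableAt_add_section n₀ n₁) n₂,
    VectorField.mlieBracket_add_right n₀ n₁,
    VectorField.mlieBracket_smul_right mdifferentiableAt_const hv,
    VectorField.mlieBracket_smul_right m₁ (S.Z₁.mdifferentiableAt x),
    VectorField.mlieBracket_smul_right m₂ (S.Z₂.mdifferentiableAt x),
    S.mlieBracket_Z_Z₁, S.mlieBracket_Z_Z₂,
    mvfderiv_oneForm_apply S.α₁ S.Z S.α₁_Z S.extDer_α₁_Z hv,
    mvfderiv_oneForm_apply S.α₂ S.Z S.α₂_Z S.extDer_α₂_Z hv, mvfderiv_const] at h₁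
  rw [map_sub, S.φ_sq x (VectorField.mlieBracket I S.Z V x), map_smul] at h₂
  have hVx : V x = v := FiberBundle.extend_apply_self ..
  rw [hVx] at h₁ h₂
  have h₃ : (2 : ℝ) • (S.hTensor x (S.φ x v) + S.φ x (S.hTensor x v)) = 0 := by
    rw [smul_add, h₁, h₂]
    simp only [zero_apply]
    module
  rw [smul_eq_zero] at h₃
  exact eq_neg_of_add_eq_zero_left (h₃.resolve_left two_ne_zero)

lemma α₁_hTensor (x : M) (v : TangentSpace I x) : S.α₁ x (S.hTensor x v) = 0 := by
  have h₁ := S.hTensor_φ_sq x v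
  rw [S.hTensor_φ] at h₁
  rw [← neg_neg (S.hTensor x v), ← h₁, map_neg, map_neg, S.α₁_φ]
  simp

lemma α₂_hTensor (x : M) (v : TangentSpace I x) : S.α₂ x (S.hTensor x v) = 0 := by
  have h₁ := S.hTensor_φ_sq x v
  rw [S.hTensor_φ] at h₁
  rw [← neg_neg (S.hTensor x v), ← h₁, map_neg, map_neg, S.α₂_φ]
  simp

lemma φ_sq_hTensor (x : M) (v : TangentSpace I x) :
    S.φ x (S.φ x (S.hTensor x v)) = - S.hTensor x v := by
  rw [S.φ_sq, S.α₁_hTensor, S.α₂_hTensor]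
  simp

/-- `∇Z = -φ - φ h`. -/
theorem leviCivita_Z (x : M) (v : TangentSpace I x) :
    leviCivita S.g S.Z x v = - S.φ x v - S.φ x (S.hTensor x v) := by
  rw [S.leviCivita_Z_eq_hTensor_φ, S.hTensor_φ]
  abel

/-- `φ` is parallel along `Z`: the difference `L_Z φ - ∇_Z φ` is the commutator of `φ` with `∇Z`,
which equals `2 h`. -/
theorem leviCivita_φ_apply_Z (hX : MDiffAt (T% X) x) :
    leviCivita S.g (fun y ↦ S.φ y (X y)) x (S.Z x) = S.φ x (leviCivita S.g X x (S.Z x)) := by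
  have hZ := S.Z.mdifferentiableAt x
  have h₁ := S.two_smul_hTensor_apply hX
  rw [← leviCivita_torsion_free S.g hZ (S.φ.mdifferentiableAt_apply hX),
    ← leviCivita_torsion_free S.g hZ hX, S.leviCivita_Z, S.leviCivita_Z, map_sub, map_sub, map_neg,
    S.φ_sq_hTensor, S.hTensor_φ, map_neg, S.φ_sq_hTensor] at h₁
  have h₂ : leviCivita S.g (fun y ↦ S.φ y (X y)) x (S.Z x)
      - S.φ x (leviCivita S.g X x (S.Z x)) = (2 : ℝ) • S.hTensor x (X x)
        - (2 : ℝ) • S.hTensor x (X x) := by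
    nth_rewrite 1 [h₁]
    module
  rw [sub_self, sub_eq_zero] at h₂
  exact h₂

/-- Regularity of `h X`, which makes the second covariant derivatives in the curvature and in
`∇_Z h` genuine derivatives rather than junk values of the connection. -/
lemma mdifferentiableAt_hTensor_apply (hX : CMDiffAt 2 (T% X) x) :
    MDiffAt (T% (fun y ↦ S.hTensor y (X y))) x := by
  have h₁ : MDiffAt (T% ((fun _ : M ↦ (1 / 2 : ℝ)) •
      (VectorField.mlieBracket I S.Z (fun y ↦ S.φ y (X y))
        - fun y ↦ S.φ y (VectorField.mlieBracket I S.Z X y)))) x :=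
    mdifferentiableAt_const.smul_section <| mdifferentiableAt_sub_section
      (mdifferentiableAt_mlieBracket (S.Z.contMDiffAt_two x) (S.φ.contMDiffAt_apply hX))
      (S.φ.mdifferentiableAt_apply (mdifferentiableAt_mlieBracket (S.Z.contMDiffAt_two x) hX))
  refine h₁.congr_of_eventuallyEq ?_
  filter_upwards [eventually_mdifferentiableAt_section hX] with y hy
  have h₂ := S.two_smul_hTensor_apply hy
  simp only [Pi.smul_apply', Pi.sub_apply, ← h₂]
  congr 1
  module

/-! ### The derivative of `h` and the curvature -/

/-- `∇_Z h` takes values in `ker α`, for a form `α` dual to a field that is parallel along `Z`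
and annihilating the values of `h`. -/
lemma oneForm_covEndo_hTensor {α : OneForm I M} {T : VField I M}
    (hα : ∀ (x : M) (v : TangentSpace I x), S.g.inner x v (T x) = α x v)
    (hαh : ∀ (x : M) (v : TangentSpace I x), α x (S.hTensor x v) = 0)
    (hT : leviCivita S.g T x (S.Z x) = 0) (hX : CMDiffAt 2 (T% X) x) :
    α x (covEndo S.g S.Z S.hTensor X x) = 0 := by
  have hm := leviCivita_metric S.g (S.Z.mdifferentiableAt x)
    (S.mdifferentiableAt_hTensor_apply hX) (T.mdifferentiableAt x)
  simp only [hα, hαh, hT, mvfderiv_const, map_zero, zero_apply, add_zero] at hm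
  rw [covEndo, map_sub, ← hm, hαh, sub_zero]

lemma φ_sq_covEndo_hTensor (hX : CMDiffAt 2 (T% X) x) :
    S.φ x (S.φ x (covEndo S.g S.Z S.hTensor X x)) = - covEndo S.g S.Z S.hTensor X x := by
  rw [S.φ_sq, S.oneForm_covEndo_hTensor S.inner_Z₁ S.α₁_hTensor (S.leviCivita_Z₁_Z x) hX,
    S.oneForm_covEndo_hTensor S.inner_Z₂ S.α₂_hTensor (S.leviCivita_Z₂_Z x) hX]
  simp

lemma covEndo_hTensor_φ (hX : CMDiffAt 2 (T% X) x) :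
    covEndo S.g S.Z S.hTensor (fun y ↦ S.φ y (X y)) x =
      - S.φ x (covEndo S.g S.Z S.hTensor X x) := by
  have hXd : MDiffAt (T% X) x := hX.mdifferentiableAt (by simp)
  have hh := S.mdifferentiableAt_hTensor_apply hX
  have e : (fun y ↦ S.hTensor y (S.φ y (X y))) =
      (-1 : ℝ) • fun y ↦ S.φ y (S.hTensor y (X y)) := by
    ext y
    rw [S.hTensor_φ]
    simp
  simp only [covEndo]
  rw [e, (leviCivita S.g).isCovariantDerivativeOnUniv.smul_const (-1)
    (S.φ.mdifferentiableAt_apply hh), smul_apply, S.leviCivita_φ_apply_Z hh,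
    S.leviCivita_φ_apply_Z hXd, S.hTensor_φ, map_sub]
  module

/-- The Jacobi operator of `Z`: since `Z` is geodesic and `∇Z = A`, one has
`R(X, Z) Z = -(∇_Z A) X - A² X`, to be evaluated at `A = -φ - φ h`. -/
theorem curvature_Z_Z (hX : CMDiffAt 2 (T% X) x) :
    curvature S.g X S.Z S.Z x = S.φ x (covEndo S.g S.Z S.hTensor X x)
      - S.φ x (S.φ x (X x)) - S.hTensor x (S.hTensor x (X x)) := by
  have hXd : MDiffAt (T% X) x := hX.mdifferentiableAt (by simp)
  have hh := S.mdifferentiableAt_hTensor_apply hX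
  have e₀ : (fun y ↦ leviCivita S.g S.Z y (S.Z y)) = 0 := by
    ext y
    exact S.leviCivita_Z_Z y
  have e₁ : (fun y ↦ leviCivita S.g S.Z y (X y)) =
      (-1 : ℝ) • fun y ↦ S.φ y ((X + fun z ↦ S.hTensor z (X z)) y) := by
    ext y
    simp only [S.leviCivita_Z, Pi.smul_apply, Pi.add_apply, map_add]
    module
  have hs : MDiffAt (T% (X + fun z ↦ S.hTensor z (X z))) x := mdifferentiableAt_add_section hXd hh
  rw [curvature, e₀, e₁, (leviCivita S.g).isCovariantDerivativeOnUniv.smul_const (-1)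
    (S.φ.mdifferentiableAt_apply hs), smul_apply, S.leviCivita_φ_apply_Z hs,
    (leviCivita S.g).isCovariantDerivativeOnUniv.add hXd hh,
    ← leviCivita_torsion_free S.g hXd (S.Z.mdifferentiableAt x), CovariantDerivative.zero]
  simp only [covEndo, S.leviCivita_Z, map_add, map_sub, map_neg, S.hTensor_φ, S.φ_sq_hTensor,
    Pi.zero_apply, zero_apply, add_apply]
  module

end MetricContactPair

lemma curvature_swap [FiniteDimensional ℝ E] (g : Metric I M)
    (X Y W : Π x : M, TangentSpace I x) (x : M) :
    curvature g X Y W x = - curvature g Y X W x := by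
  simp only [curvature, VectorField.mlieBracket_swap_apply (V := X) (W := Y), map_neg]
  abel

end ContactPairs

theorem mainTheorem9
    {E : Type*} [NormedAddCommGroup E] [NormedSpace ℝ E] [FiniteDimensional ℝ E]
    {H : Type*} [TopologicalSpace H] (I : ModelWithCorners ℝ E H) [I.Boundaryless]
    {M : Type*} [TopologicalSpace M] [ChartedSpace H M] [IsManifold I ∞ M]
    (h k : ℕ) (S : ContactPairs.MetricContactPair I M h k) (hS : S.IsDecomposable)
    (X : ContactPairs.VField I M) (x : M) :
    ContactPairs.covEndo S.g S.Z S.hTensor X x =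
        S.φ x (X x) - S.hTensor x (S.hTensor x (S.φ x (X x)))
          - S.φ x (ContactPairs.curvature S.g X S.Z S.Z x) ∧
      (1 / 2 : ℝ) • (ContactPairs.curvature S.g S.Z X S.Z x
          - S.φ x (ContactPairs.curvature S.g S.Z (fun y ↦ S.φ y (X y)) S.Z x)) =
        S.φ x (S.φ x (X x)) + S.hTensor x (S.hTensor x (X x)) := by
  have hX := X.contMDiffAt_two x
  have hφX := S.φ.contMDiffAt_apply hX
  constructor
  · rw [S.curvature_Z_Z hX]
    simp only [map_sub, S.φ_sq_covEndo_hTensor hX, S.φ_cube, S.hTensor_φ, map_neg]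
    module
  · rw [ContactPairs.curvature_swap S.g S.Z X,
      ContactPairs.curvature_swap S.g S.Z (fun y ↦ S.φ y (X y)),
      S.curvature_Z_Z hX, S.curvature_Z_Z hφX, S.covEndo_hTensor_φ hX]
    simp only [map_sub, map_neg, S.φ_sq_covEndo_hTensor hX, S.φ_cube, S.hTensor_φ,
      S.φ_sq_hTensor]
    module
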